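/- Let $\mathcal K$ be a complete chain graph on a finite vertex set $\vec V$ (a graph with directed and undirected edges, at most one edge between two vertices, no partially directed cycle, any two vertices adjacent), and let each $V\in\vec V$ have a countable discrete state space $\mathfrak X_V$. Write $\mathcal B(\cdot)$ for the set of blocks of a chain graph (the connected components of its undirected part), and $\mathrm{pa}$, $\mathrm{nb}$ for parents and neighbours. A chain graph causal model consists of random vectors $\vec B(\vec a_{\vec B})$ with values in $\mathfrak X_{\vec B}$, one for every $\vec B\in\mathcal B(\mathcal K)$ and $\vec a_{\vec B}\in\mathfrak X_{\mathrm{pa}_{\mathcal K}(\vec B)}$, each with a strictly positive law, such that the families $\{\vec B(\vec a_{\vec B})\}_{\vec a_{\vec B}}$, for distinct $\vec B$, are mutually independent. A set $\vec A\subseteq\vec V$ is a valid intervention set if it is a union of blocks of $\mathcal K$. For a value $\vec a$ of a valid $\vec A$, responses are defined by recursive substitution: $\vec B(\vec a)$ is the one step ahead block $\vec B(\cdot)$ in which every parent in $\vec A$ is set to its value in $\vec a$, and every other parent to its own response to $\vec a$. The observed variables are the responses with $\vec A=\emptyset$. Let $\mathcal G$ be an edge subgraph of $\mathcal K$ (hence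 a chain graph), and suppose that the model is in the submodel associated with $\mathcal G$: for all $\vec B\in\mathcal B(\mathcal K)$, $B\in\vec B$ and $\vec a_{\vec B}$, the conditional probability $p\{B(\vec a_{\vec B})\mid(\vec B\setminus\{B\})(\vec a_{\vec B})\}$ is a function only of $B$, of $\mathrm{nb}_{\mathcal G}(B)$ and of the restriction of $\vec a_{\vec B}$ to $\mathrm{pa}_{\mathcal G}(B)$. For $\vec B\in\mathcal B(\mathcal G)$ let $\mathrm{fa}_{\mathcal G}(\vec B)=\mathrm{pa}_{\mathcal G}(\vec B)\cup\vec B$, and let $\mathcal C_{\vec B}$ be the set of those maximal cliques of the undirected graph $(\mathcal G_{\mathrm{fa}_{\mathcal G}(\vec B)})^a$ (vertices $\mathrm{fa}_{\mathcal G}(\vec B)$; two vertices joined if adjacent in $\mathcal G$ or both in $\mathrm{pa}_{\mathcal G}(\vec B)\setminus\vec B$) that are not contained in $\mathrm{pa}_{\mathcal G}(\vec B)$. For potentials $\phi_{\vec C}:\mathfrak X_{\vec C}\to[0,\infty)$, put $$f_{\vec B}(\vec x)=\frac{\prod_{\vec C\in\mathcal C_{\vec B}}\phi_{\vec C}(\vec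 x_{\vec C})}{Z_{\vec B}(\vec x_{\mathrm{pa}_{\mathcal G}(\vec B)})},\qquad Z_{\vec B}(\vec x_{\mathrm{pa}_{\mathcal G}(\vec B)})=\sum_{\vec x_{\vec B}}\ \prod_{\vec C\in\mathcal C_{\vec B}}\phi_{\vec C}(\vec x_{\vec C}).$$ Then there are potentials $\phi_{\vec C}$ with which the observed law factorises as $p(\vec V=\vec x)=\prod_{\vec B\in\mathcal B(\mathcal G)}f_{\vec B}(\vec x)$ for all $\vec x\in\mathfrak X_{\vec V}$. Moreover, for any such potentials, any valid $\vec A$ and any $\vec a\in\mathfrak X_{\vec A}$, the responses satisfy $$p\big(\{\vec V\setminus\vec A\}(\vec a)=\vec v\big)=\prod_{\vec B\in\mathcal B(\mathcal G),\ \vec B\cap\vec A=\emptyset} f_{\vec B}(\vec a,\vec v)\qquad\text{for all }\vec v\in\mathfrak X_{\vec V\setminus\vec A},$$ and, for every $\vec Y\subseteq\vec V\setminus\vec A$ and every $\vec y\in\mathfrak X_{\vec Y}$, $$p\big(\vec Y(\vec a)=\vec y\big)=\sum_{\vec w\in\mathfrak X_{\vec V\setminus(\vec A\cup\vec Y)}}\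 \prod_{\vec B\in\mathcal B(\mathcal G),\ \vec B\cap\vec A=\emptyset} f_{\vec B}(\vec a,\vec y,\vec w).$$ -/

import Mathlib

open MeasureTheory ProbabilityTheory
open scoped ENNReal NNReal

/-- A mixed graph: directed edges `Dir u v` (read `u → v`) and undirected edges, with no loops and
at most one edge between any two vertices. -/
structure MixedGraph (V : Type*) where
  Dir : V → V → Prop
  undir : SimpleGraph V
  dir_irrefl : ∀ u, ¬ Dir u u
  dir_asymm : ∀ u v, Dir u v → ¬ Dir v u
  dir_not_undir : ∀ u v, Dir u v → ¬ undir.Adj u v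

namespace MixedGraph

variable {V : Type*}

/-- One step of a partially directed path. -/
def SemiDir (G : MixedGraph V) (u v : V) : Prop := G.Dir u v ∨ G.undir.Adj u v

/-- A chain graph has no partially directed cycle: there is no partially directed path from `u` to
`v` together with a directed edge from `v` to `u`. (A partially directed walk can be shortened to
one without repeated vertices, so walks may be used in place of paths.) -/
def IsChainGraph (G : MixedGraph V) : Prop :=
  ∀ u v, Relation.ReflTransGen G.SemiDir u v → ¬ G.Dir v u

/-- Two vertices are adjacent if some edge, of either kind and orientation, joins them. -/
def Adjacent (G : MixedGraph V) (u v : V) : Prop := G.Dir u v ∨ G.Dir v u ∨ G.undir.Adj u v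

/-- Any two distinct vertices are adjacent. -/
def IsComplete (G : MixedGraph V) : Prop := ∀ u v, u ≠ v → G.Adjacent u v

/-- `G` is obtained from `K` by deleting edges, on the same vertex set. -/
def IsEdgeSubgraph (G K : MixedGraph V) : Prop :=
  (∀ u v, G.Dir u v → K.Dir u v) ∧ G.undir ≤ K.undir

/-- Parents of a set of vertices. -/
def pa (G : MixedGraph V) (S : Set V) : Set V := {u | ∃ v ∈ S, G.Dir u v}

/-- The family of a set of vertices. -/
def fa (G : MixedGraph V) (S : Set V) : Set V := G.pa S ∪ S

/-- Blocks: connected components of the undirected part; `B.supp` is the set of vertices of `B`. -/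
abbrev Block (G : MixedGraph V) : Type _ := G.undir.ConnectedComponent

/-- The block of a vertex. -/
abbrev blockOf (G : MixedGraph V) (v : V) : G.Block := G.undir.connectedComponentMk v

/-- A valid intervention set: it contains every block that it meets. -/
def IsValid (G : MixedGraph V) (A : Set V) : Prop :=
  ∀ B : G.Block, (B.supp ∩ A).Nonempty → B.supp ⊆ A

/-- The undirected graph `(G_{fa(S)})^a`: on the vertices in `fa(S)`, two distinct vertices are
joined if they are adjacent in `G` or both lie in `pa(S) \ S`. (It is carried by the type of all
vertices; cliques are required below to lie in `fa(S)`.) -/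
def augmented (G : MixedGraph V) (S : Set V) : SimpleGraph V where
  Adj u v := u ≠ v ∧ u ∈ G.fa S ∧ v ∈ G.fa S ∧
    (G.Adjacent u v ∨ (u ∈ G.pa S \ S ∧ v ∈ G.pa S \ S))
  symm := ⟨by
    rintro u v ⟨h, hu, hv, h'⟩
    refine ⟨h.symm, hv, hu, ?_⟩
    rcases h' with (h' | h' | h') | h'
    · exact Or.inl (Or.inr (Or.inl h'))
    · exact Or.inl (Or.inl h')
    · exact Or.inl (Or.inr (Or.inr h'.symm))
    · exact Or.inr h'.symm⟩
  loopless := ⟨fun _ h => h.1 rfl⟩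

/-- `C` is a maximal clique of `(G_{fa(S)})^a`. -/
def IsMaxClique (G : MixedGraph V) (S C : Set V) : Prop :=
  Maximal (fun D : Set V => D ⊆ G.fa S ∧ (G.augmented S).IsClique D) C

/-- The maximal cliques of `(G_{fa(B)})^a` that are not contained in `pa(B)`. -/
noncomputable def cliques [Finite V] (G : MixedGraph V) (B : G.Block) : Finset (Set V) :=
  (Set.toFinite {C : Set V | G.IsMaxClique B.supp C ∧ ¬ C ⊆ G.pa B.supp}).toFinset

/-- The blocks disjoint from `A`. -/
noncomputable def blocksAvoiding [Finite V] (G : MixedGraph V) (A : Set V) : Finset G.Block :=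
  (Set.toFinite {B : G.Block | Disjoint B.supp A}).toFinset

/-- `u` is a parent of the block of `v`. -/
def BlockParent (G : MixedGraph V) (u v : V) : Prop := u ∈ G.pa (G.blockOf v).supp

theorem semiDir_of_reachable (G : MixedGraph V) {u v : V} (h : G.undir.Reachable u v) :
    Relation.ReflTransGen G.SemiDir u v :=
  Relation.ReflTransGen.mono (fun _ _ h => Or.inr h) _ _
    ((SimpleGraph.reachable_iff_reflTransGen u v).1 h)

theorem exists_of_transGen (G : MixedGraph V) {u v : V}
    (h : Relation.TransGen G.BlockParent u v) :
    ∃ w, G.Dir u w ∧ Relation.ReflTransGen G.SemiDir w v := by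
  induction h with
  | single h =>
    obtain ⟨w, hw, hd⟩ := h
    exact ⟨w, hd, G.semiDir_of_reachable (SimpleGraph.ConnectedComponent.exact hw)⟩
  | tail _ h ih =>
    obtain ⟨w, hw, hd⟩ := h
    obtain ⟨w', hd', hp⟩ := ih
    exact ⟨w', hd', (hp.tail (Or.inl hd)).trans
      (G.semiDir_of_reachable (SimpleGraph.ConnectedComponent.exact hw))⟩

/-- In a finite chain graph, recursion along parents of blocks is well founded. -/
theorem IsChainGraph.wellFounded [Finite V] {G : MixedGraph V} (hG : G.IsChainGraph) :
    WellFounded G.BlockParent := by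
  have : Std.Irrefl (Relation.TransGen G.BlockParent) := ⟨fun a h => by
    obtain ⟨w, hd, hp⟩ := G.exists_of_transGen h
    exact hG _ _ hp hd⟩
  have h : WellFounded (Relation.TransGen G.BlockParent) :=
    Finite.wellFounded_of_trans_of_irrefl _
  exact Subrelation.wf (fun h => Relation.TransGen.single h) h

end MixedGraph

/-- Joint values of the variables in `S`. -/
abbrev Config {V : Type*} (X : V → Type*) (S : Set V) : Type _ := ∀ u : S, X u

open Classical in
/-- The values of all variables given by `a` on `S` and by `v` off `S`. -/
noncomputable def glue {V : Type*} {X : V → Type*} (S : Set V) (a : Config X S)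
    (v : Config X Sᶜ) : ∀ u, X u :=
  fun u => if h : u ∈ S then a ⟨u, h⟩ else v ⟨u, h⟩

open Classical in
/-- The values on `S` given by `y` on `Y` and by `w` on `S \ Y`. -/
noncomputable def mergeValues {V : Type*} {X : V → Type*} {S : Set V} (Y : Set V) (y : Config X Y)
    (w : Config X (S \ Y)) : Config X S :=
  fun u => if h : (u : V) ∈ Y then y ⟨u, h⟩ else w ⟨u, u.2, h⟩

section Model

variable {V : Type*} [Finite V] {X : V → Type*} [∀ v, MeasurableSpace (X v)]
  {Ω : Type*} [MeasurableSpace Ω]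

/-- A chain graph causal model over the blocks of `K`: one step ahead blocks `step B a`, for every
block `B` of `K` and all values `a` of the parents of `B`. The families `(step B a)_a`, for distinct
blocks `B`, are mutually independent, and every one step ahead block has a positive law. -/
structure SaturatedCGM (K : MixedGraph V) (X : V → Type*) [∀ v, MeasurableSpace (X v)]
    (μ : Measure Ω) where
  step : (B : K.Block) → Config X (K.pa B.supp) → Ω → Config X B.supp
  measurable_step : ∀ B a, Measurable (step B a)
  indep : iIndepFun (fun (B : K.Block) (ω : Ω) (a : Config X (K.pa B.supp)) => step B a ω) μ
  pos : ∀ B a b, 0 < μ {ω | step B a ω = b}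

namespace SaturatedCGM

variable {K : MixedGraph V} {μ : Measure Ω}

open Classical in
/-- Responses to the intervention that sets `A` to `a`, by recursive substitution: the block of `v`
is the one step ahead block whose parents take their value in `a` if they are in `A`, and otherwise
their own response to the intervention. -/
noncomputable def response (M : SaturatedCGM K X μ) (hK : K.IsChainGraph) (A : Set V)
    (a : Config X A) (ω : Ω) : ∀ v, X v :=
  hK.wellFounded.fix fun v rec =>
    M.step (K.blockOf v)
      (fun u => if h : (u : V) ∈ A then a ⟨u, h⟩ else rec u u.2) ω ⟨v, rfl⟩

/-- The observed variables: the responses when nothing is intervened on. -/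
noncomputable def observed (M : SaturatedCGM K X μ) (hK : K.IsChainGraph) (ω : Ω) : ∀ v, X v :=
  M.response hK ∅ (fun u => absurd u.2 (Set.notMem_empty _)) ω

/-- The restrictions given by the edges of `K` missing in `G`: for every block `B` of `K` and
`i ∈ B`, the conditional probability `p(B_i(a) = b_i | (B \ {i})(a) = b_{B \ {i}})` is a function
only of the values of `a` on the `G`-parents of `i`, of `b_i`, and of the values of `b` on the
`G`-neighbours of `i`. -/
def IsRestrictedTo (M : SaturatedCGM K X μ) (G : MixedGraph V) : Prop :=
  ∀ (B : K.Block) (i : B.supp) (a a' : Config X (K.pa B.supp)) (b b' : Config X B.supp),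
    (∀ u : K.pa B.supp, G.Dir u i → a u = a' u) →
    b i = b' i →
    (∀ j : B.supp, G.undir.Adj i j → b j = b' j) →
    (cond μ {ω | ∀ j, j ≠ i → M.step B a ω j = b j}) {ω | M.step B a ω i = b i} =
      (cond μ {ω | ∀ j, j ≠ i → M.step B a' ω j = b' j}) {ω | M.step B a' ω i = b' i}

end SaturatedCGM

end Model

/-- A family of potential functions: `φ C` maps values of the variables in `C` to non-negative
real numbers. -/
abbrev Potentials {V : Type*} (X : V → Type*) : Type _ := (C : Set V) → Config X C → ℝ≥0

namespace Potentials

variable {V : Type*} [Finite V] {X : V → Type*}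

/-- The product of the potentials of the relevant cliques of the block `B`, at the values `x`
(only the coordinates of `x` in `fa(B)` matter). -/
noncomputable def weight (φ : Potentials X) (G : MixedGraph V) (B : G.Block) (x : ∀ u, X u) :
    ℝ≥0∞ :=
  ∏ C ∈ G.cliques B, (φ C (fun u => x u) : ℝ≥0∞)

/-- The normalising function `Z_B` (only the coordinates of `x` in `pa(B)` matter). -/
noncomputable def Z (φ : Potentials X) (G : MixedGraph V) (B : G.Block) (x : ∀ u, X u) : ℝ≥0∞ :=
  ∑' b : Config X B.supp, φ.weight G B (glue B.supp b (fun u => x u))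

/-- The product of the normalised factors of the blocks disjoint from `A`. -/
noncomputable def truncated (φ : Potentials X) (G : MixedGraph V) (A : Set V) (x : ∀ u, X u) :
    ℝ≥0∞ :=
  ∏ B ∈ G.blocksAvoiding A, φ.weight G B x / φ.Z G B x

/-- The law of the observed variables factorises according to `G` with potentials `φ`. -/
def FactorizesObserved [∀ v, MeasurableSpace (X v)] {Ω : Type*} [MeasurableSpace Ω]
    {K : MixedGraph V} {μ : Measure Ω} (φ : Potentials X) (G : MixedGraph V)
    (M : SaturatedCGM K X μ) (hK : K.IsChainGraph) : Prop :=
  ∀ x : ∀ u, X u, μ {ω | M.observed hK ω = x} = φ.truncated G ∅ x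

end Potentials

/-!
For a block `B` of `K` let `p_B(x)` be the probability that the one step ahead block `B`, with
parents set according to `x`, takes the values `x_B`. Unfolding the recursive substitution, the
responses to an intervention on a valid set `A` equal given values exactly when every one step ahead
block avoiding `A` does, with parents set to those values (`response_eq_iff`). Independence then
gives the law of the responses as the product of the `p_B` over the blocks `B` of `K` avoiding `A`
(`measure_response`). It remains to relate the `p_B` to the kernels `weight / Z` of the blocks of
`G`.

*Existence.* The Hammersley–Clifford argument is applied to each `p_B`. Let `H(x)` be the logarithm
of `p_B(x)` divided by its value with `x_B` replaced by fixed reference values. Möbius inversion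
writes `H` as a sum of interactions over sets `D` of vertices (`sum_interaction`). The restriction
to `G` says that the effect on `H` of a vertex `i` of `B` depends only on `i`, its `G`-neighbours
and its `G`-parents. Hence an interaction vanishes unless `D` meets `B` and each vertex of `D` in
`B` is joined to all others in `D`, that is, unless `D` is a clique of `(G_{fa(B')})^a` meeting `B'`
for some block `B'` of `G` inside `B` (`exists_isRelevantClique`). Since `G` is a chain graph, `B'`
is unique, and `D` can be absorbed into a maximal clique. No directed edge of `G` joins two vertices
of `B`, so the sum over `x_B` factorises into the normalising functions `Z_{B'}`, and `p_B` is the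
product of the kernels of the blocks `B'` of `G` inside `B` (`exists_blockProb_eq_prod_kernel`).

*Uniqueness.* Potentials that factorise the observed law define positive normalised kernels, because
that law is positive. Summing out the variables of a terminal block removes its kernel from the
product, so that the kernels are determined by their product (`kernel_unique`). The kernels of any
such potentials are therefore those found above, and the `p_B` with `B` avoiding `A` multiply to
the truncated product, as every block of `G` avoiding the valid set `A` lies in a block of `K`
avoiding `A`.
-/

/-! ### Chain graphs and their blocks -/

namespace MixedGraph

variable {V : Type*} {G K : MixedGraph V}

theorem IsEdgeSubgraph.isChainGraph (h : G.IsEdgeSubgraph K) (hK : K.IsChainGraph) :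
    G.IsChainGraph := fun u v huv hvu =>
  hK u v (Relation.ReflTransGen.mono (fun _ _ => Or.imp (h.1 _ _) (fun h' => h.2 h')) _ _ huv)
    (h.1 _ _ hvu)

/-- Blocks of a chain graph cannot be parents of each other; the case `B = B'` says that a block
does not meet its own parents. -/
theorem IsChainGraph.disjoint_pa_or_disjoint_pa (hG : G.IsChainGraph) (B B' : G.Block) :
    Disjoint (G.pa B.supp) B'.supp ∨ Disjoint (G.pa B'.supp) B.supp := by
  by_contra! h
  obtain ⟨u, ⟨v, hv, huv⟩, hu⟩ := Set.not_disjoint_iff.1 h.1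
  obtain ⟨u', ⟨v', hv', huv'⟩, hu'⟩ := Set.not_disjoint_iff.1 h.2
  have h₁ := G.semiDir_of_reachable (B.reachable_of_mem_supp hv hu')
  have h₂ := G.semiDir_of_reachable (B'.reachable_of_mem_supp hv' hu)
  exact hG _ _ ((h₁.tail (Or.inl huv')).trans h₂) huv

theorem IsChainGraph.disjoint_pa (hG : G.IsChainGraph) (B : G.Block) :
    Disjoint (G.pa B.supp) B.supp :=
  (hG.disjoint_pa_or_disjoint_pa B B).elim id id

theorem disjoint_supp {B B' : G.Block} (h : B ≠ B') : Disjoint B.supp B'.supp :=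
  Set.disjoint_left.2 fun _ hu hu' => h (hu.symm.trans hu')

/-- A nonempty finite set of blocks of a chain graph has a terminal element. -/
theorem IsChainGraph.exists_terminal (hG : G.IsChainGraph) {S : Finset G.Block}
    (hS : S.Nonempty) : ∃ T ∈ S, ∀ B ∈ S, Disjoint T.supp (G.pa B.supp) := by
  -- A block with a maximal set of anterior vertices is terminal.
  let anterior : G.Block → Set V := fun B => {u | ∃ v ∈ B.supp, Relation.ReflTransGen G.SemiDir u v}
  obtain ⟨T, hT, hmax⟩ := S.exists_maximalFor anterior hS
  refine ⟨T, hT, fun B hB => Set.disjoint_left.2 ?_⟩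
  rintro u hu ⟨w, hw, huw⟩
  have hle : anterior T ≤ anterior B := by
    rintro z ⟨v, hv, hzv⟩
    exact ⟨w, hw, (hzv.trans (G.semiDir_of_reachable (T.reachable_of_mem_supp hv hu))).tail
      (Or.inl huw)⟩
  obtain ⟨t, ht, hwt⟩ := hmax hB hle ⟨w, hw, .refl⟩
  exact hG _ _ (hwt.trans (G.semiDir_of_reachable (T.reachable_of_mem_supp ht hu))) huw

theorem subset_fa_of_mem_cliques [Finite V] {B : G.Block} {C : Set V} (hC : C ∈ G.cliques B) :
    C ⊆ G.fa B.supp :=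
  ((Set.Finite.mem_toFinset _).1 hC).1.prop.1

/-- A relevant clique of a block meets that block. -/
theorem exists_mem_supp_of_mem_cliques [Finite V] {B : G.Block} {C : Set V}
    (hC : C ∈ G.cliques B) : ∃ u ∈ C, u ∈ B.supp := by
  obtain ⟨u, hu, hu'⟩ := Set.not_subset.1 ((Set.Finite.mem_toFinset _).1 hC).2
  exact ⟨u, hu, (subset_fa_of_mem_cliques hC hu).resolve_left hu'⟩

/-- A set of vertices determines the block whose family contains it and which it meets. -/
theorem IsChainGraph.block_unique (hG : G.IsChainGraph) {B B' : G.Block} {C : Set V}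
    (hB : C ⊆ G.fa B.supp) (hCB : ∃ u ∈ C, u ∈ B.supp)
    (hB' : C ⊆ G.fa B'.supp) (hCB' : ∃ u ∈ C, u ∈ B'.supp) : B = B' := by
  by_contra hne
  obtain ⟨u, hu, hu'⟩ := hCB
  obtain ⟨v, hv, hv'⟩ := hCB'
  rcases hG.disjoint_pa_or_disjoint_pa B B' with h | h
  · exact (hB hv).elim (fun hp => Set.disjoint_left.1 h hp hv')
      (fun hp => Set.disjoint_left.1 (disjoint_supp hne) hp hv')
  · exact (hB' hu).elim (fun hp => Set.disjoint_left.1 h hp hu')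
      (fun hp => Set.disjoint_left.1 (disjoint_supp hne) hu' hp)

/-- The blocks of `G` that are contained in a given set of vertices. -/
noncomputable def blocksWithin [Finite V] (G : MixedGraph V) (S : Set V) : Finset G.Block :=
  (Set.toFinite {B : G.Block | B.supp ⊆ S}).toFinset

theorem mem_blocksWithin [Finite V] {S : Set V} {B : G.Block} :
    B ∈ G.blocksWithin S ↔ B.supp ⊆ S := by simp [blocksWithin]

theorem mem_blocksAvoiding [Finite V] {A : Set V} {B : G.Block} :
    B ∈ G.blocksAvoiding A ↔ Disjoint B.supp A := by simp [blocksAvoiding]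

/-- The block of `K` that contains a given block of the edge subgraph `G`. -/
def IsEdgeSubgraph.coarsen (h : G.IsEdgeSubgraph K) (B : G.Block) : K.Block :=
  B.map (SimpleGraph.Hom.ofLE h.2)

theorem IsEdgeSubgraph.supp_subset_coarsen (h : G.IsEdgeSubgraph K) (B : G.Block) :
    B.supp ⊆ (h.coarsen B).supp := by
  rintro u rfl
  rfl

theorem IsEdgeSubgraph.coarsen_eq_iff (h : G.IsEdgeSubgraph K) {B : G.Block} {B' : K.Block} :
    h.coarsen B = B' ↔ B.supp ⊆ B'.supp := by
  constructor
  · rintro rfl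
    exact h.supp_subset_coarsen B
  · intro hB
    obtain ⟨u, hu⟩ := B.nonempty_supp
    exact (h.supp_subset_coarsen B hu).symm.trans (hB hu)

theorem IsEdgeSubgraph.pa_subset (h : G.IsEdgeSubgraph K) {B : K.Block} {B' : G.Block}
    (hB : B'.supp ⊆ B.supp) : G.pa B'.supp ⊆ K.pa B.supp := by
  rintro u ⟨v, hv, huv⟩
  exact ⟨v, hB hv, h.1 _ _ huv⟩

/-- For a valid set `A`, the blocks of `G` avoiding `A` are those inside blocks of `K`
avoiding `A`. -/
theorem IsEdgeSubgraph.prod_blocksAvoiding [Finite V] (h : G.IsEdgeSubgraph K) {A : Set V}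
    (hA : K.IsValid A) {R : Type*} [CommMonoid R] (f : G.Block → R) :
    ∏ B ∈ G.blocksAvoiding A, f B =
      ∏ B ∈ K.blocksAvoiding A, ∏ B' ∈ G.blocksWithin B.supp, f B' := by
  classical
  rw [← Finset.prod_fiberwise_of_maps_to (g := h.coarsen) (t := K.blocksAvoiding A)]
  · refine Finset.prod_congr rfl fun B hB => Finset.prod_congr ?_ fun _ _ => rfl
    ext B'
    rw [Finset.mem_filter, mem_blocksAvoiding, mem_blocksWithin, h.coarsen_eq_iff]
    exact ⟨fun h => h.2, fun h => ⟨(mem_blocksAvoiding.1 hB).mono_left h, h⟩⟩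
  · intro B hB
    rw [mem_blocksAvoiding] at hB ⊢
    by_contra hn
    obtain ⟨u, hu⟩ := B.nonempty_supp
    exact Set.disjoint_left.1 hB hu
      (hA _ (Set.not_disjoint_iff_nonempty_inter.1 hn) (h.supp_subset_coarsen B hu))

end MixedGraph

/-! ### Summing out coordinates -/

section Glue

variable {V : Type*} {X : V → Type*}

theorem glue_of_mem {S : Set V} (a : Config X S) (v : Config X Sᶜ) {u : V} (h : u ∈ S) :
    glue S a v u = a ⟨u, h⟩ := dif_pos h

theorem glue_of_notMem {S : Set V} (a : Config X S) (v : Config X Sᶜ) {u : V} (h : u ∉ S) :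
    glue S a v u = v ⟨u, h⟩ := dif_neg h

theorem glue_restrict (S : Set V) (x : ∀ u, X u) :
    glue S (fun u => x u) (fun u => x u) = x := by
  funext u
  by_cases h : u ∈ S
  · exact glue_of_mem _ _ h
  · exact glue_of_notMem _ _ h

theorem restrict_glue (S : Set V) (a : Config X S) (v : Config X Sᶜ) :
    (fun u : S => glue S a v u) = a :=
  funext fun u => glue_of_mem a v u.2

/-- Overwriting the same coordinates preserves agreement. -/
theorem glue_congr {S : Set V} (b : Config X S) {x y : ∀ u, X u} {u : V} (h : u ∉ S → x u = y u) :
    glue S b (fun u => x u) u = glue S b (fun u => y u) u := by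
  by_cases hu : u ∈ S
  · rw [glue_of_mem _ _ hu, glue_of_mem _ _ hu]
  · rw [glue_of_notMem _ _ hu, glue_of_notMem _ _ hu, h hu]

/-- A function that does not depend on the coordinates in `S` is unchanged by overwriting them. -/
theorem DependsOn.apply_glue {β : Type*} {f : (∀ u, X u) → β} {F S : Set V} (hf : DependsOn f F)
    (h : Disjoint F S) (b : Config X S) (x : ∀ u, X u) : f (glue S b (fun u => x u)) = f x :=
  hf fun _ hu => glue_of_notMem _ _ (Set.disjoint_left.1 h hu)

open Classical in
/-- Values on a disjoint union are pairs of values. -/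
noncomputable def configUnionEquiv {P Q : Set V} (h : Disjoint P Q) :
    Config X (P ∪ Q) ≃ Config X P × Config X Q where
  toFun b := (fun u => b ⟨u, Or.inl u.2⟩, fun u => b ⟨u, Or.inr u.2⟩)
  invFun p u := if hu : (u : V) ∈ P then p.1 ⟨u, hu⟩ else p.2 ⟨u, u.2.resolve_left hu⟩
  left_inv b := by
    funext u
    by_cases hu : (u : V) ∈ P <;> simp [hu]
  right_inv p := by
    refine Prod.ext (funext fun u => ?_) (funext fun u => ?_)
    · simp
    · have : (u : V) ∉ P := fun hu => Set.disjoint_left.1 h hu u.2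
      simp [this]

theorem tsum_glue_union {P Q : Set V} (h : Disjoint P Q) (F : (∀ u, X u) → ℝ≥0∞)
    (x : ∀ u, X u) :
    ∑' b : Config X (P ∪ Q), F (glue (P ∪ Q) b (fun u => x u)) =
      ∑' (p : Config X P) (q : Config X Q),
        F (glue Q q (fun u => glue P p (fun u => x u) u)) := by
  rw [← ENNReal.tsum_prod, ← (configUnionEquiv h).tsum_eq]
  refine tsum_congr fun b => congrArg F (funext fun u => ?_)
  by_cases hQ : u ∈ Q
  · rw [glue_of_mem _ _ hQ, glue_of_mem _ _ (Set.mem_union_right P hQ)]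
    rfl
  · rw [glue_of_notMem _ _ hQ]
    by_cases hP : u ∈ P
    · rw [glue_of_mem _ _ hP, glue_of_mem _ _ (Set.mem_union_left Q hP)]
      rfl
    · rw [glue_of_notMem _ _ hP, glue_of_notMem _ _ (by simp [hP, hQ])]

/-- Factors with separate summation variables can be summed separately. -/
theorem tsum_glue_prod {ι : Type*} (S : Finset ι) {P F : ι → Set V}
    (hP : ∀ i ∈ S, ∀ j ∈ S, i ≠ j → Disjoint (P i) (P j))
    (hF : ∀ i ∈ S, ∀ j ∈ S, i ≠ j → Disjoint (F i) (P j))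
    {w : ι → (∀ u, X u) → ℝ≥0∞} (hw : ∀ i ∈ S, DependsOn (w i) (F i))
    {Q : Set V} (hQ : Q = ⋃ i ∈ S, P i) (x : ∀ u, X u) :
    ∑' b : Config X Q, ∏ i ∈ S, w i (glue Q b (fun u => x u)) =
      ∏ i ∈ S, ∑' b : Config X (P i), w i (glue (P i) b (fun u => x u)) := by
  classical
  induction S using Finset.induction_on generalizing Q x with
  | empty =>
    have : Q = ∅ := by simp [hQ]
    subst this
    have : Unique (Config X (∅ : Set V)) := Pi.uniqueOfIsEmpty _
    simp
  | insert i S hi ih =>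
    have hmem : ∀ j ∈ S, j ∈ insert i S := fun j => Finset.mem_insert_of_mem
    have hne : ∀ j ∈ S, i ≠ j := fun j hj => by
      rintro rfl
      exact hi hj
    have hii := Finset.mem_insert_self i S
    replace ih := ih (fun j hj k hk => hP j (hmem j hj) k (hmem k hk))
      (fun j hj k hk => hF j (hmem j hj) k (hmem k hk)) (fun j hj => hw j (hmem j hj)) rfl
    rw [Finset.set_biUnion_insert] at hQ
    subst hQ
    have hdisj : Disjoint (P i) (⋃ j ∈ S, P j) :=
      Set.disjoint_iUnion₂_right.2 fun j hj => hP i hii j (hmem j hj) (hne j hj)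
    have hdisj' : Disjoint (F i) (⋃ j ∈ S, P j) :=
      Set.disjoint_iUnion₂_right.2 fun j hj => hF i hii j (hmem j hj) (hne j hj)
    rw [tsum_glue_union hdisj (fun x => ∏ j ∈ insert i S, w j x), Finset.prod_insert hi,
      ← ENNReal.tsum_mul_right]
    refine tsum_congr fun p => ?_
    simp_rw [Finset.prod_insert hi, (hw i hii).apply_glue hdisj']
    rw [ENNReal.tsum_mul_left, ih]
    congr 1
    refine Finset.prod_congr rfl fun j hj => tsum_congr fun b => hw j (hmem j hj) fun u hu => ?_
    exact glue_congr b fun _ => glue_of_notMem _ _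
      (Set.disjoint_left.1 (hF j (hmem j hj) i hii (hne j hj).symm) hu)

end Glue

/-! ### Factorisations into normalised kernels are unique -/

namespace MixedGraph

variable {V : Type*} {G : MixedGraph V} {X : V → Type*}

/-- Two families of normalised kernels indexed by the blocks of a chain graph agree if their
products agree: summing out the variables of a terminal block removes its kernel from both
products. -/
theorem IsChainGraph.kernel_unique (hG : G.IsChainGraph)
    {f g : G.Block → (∀ u, X u) → ℝ≥0∞}
    (hf : ∀ B, DependsOn (f B) (G.fa B.supp)) (hg : ∀ B, DependsOn (g B) (G.fa B.supp))
    (hf₁ : ∀ B (x : ∀ u, X u), ∑' b : Config X B.supp, f B (glue B.supp b (fun u => x u)) = 1)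
    (hg₁ : ∀ B (x : ∀ u, X u), ∑' b : Config X B.supp, g B (glue B.supp b (fun u => x u)) = 1)
    (hf₀ : ∀ B x, f B x ≠ 0) (S : Finset G.Block)
    (h : ∀ x, ∏ B ∈ S, f B x = ∏ B ∈ S, g B x) : ∀ B ∈ S, f B = g B := by
  classical
  have htop : ∀ B x, f B x ≠ ∞ := fun B x => by
    refine ne_top_of_le_ne_top ENNReal.one_ne_top ((?_ : _ ≤ _).trans_eq (hf₁ B x))
    simpa only [glue_restrict] using
      ENNReal.le_tsum (f := fun b => f B (glue B.supp b (fun u => x u))) (fun u => x u)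
  induction S using Finset.strongInduction with
  | H S ih =>
    rcases S.eq_empty_or_nonempty with rfl | hS
    · simp
    obtain ⟨T, hT, hterm⟩ := hG.exists_terminal hS
    -- The kernels other than that of `T` do not involve the variables of `T`.
    have hdisj : ∀ B ∈ S.erase T, Disjoint (G.fa B.supp) T.supp := fun B hB =>
      Set.disjoint_union_left.2 ⟨(hterm B (Finset.mem_of_mem_erase hB)).symm,
        disjoint_supp (Finset.ne_of_mem_erase hB)⟩
    have hsum : ∀ k : G.Block → (∀ u, X u) → ℝ≥0∞, (∀ B, DependsOn (k B) (G.fa B.supp)) →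
        (∀ B (x : ∀ u, X u), ∑' b : Config X B.supp, k B (glue B.supp b (fun u => x u)) = 1) →
        ∀ x, ∑' b : Config X T.supp, ∏ B ∈ S, k B (glue T.supp b (fun u => x u)) =
          ∏ B ∈ S.erase T, k B x := by
      intro k hk hk₁ x
      have : ∀ b : Config X T.supp, ∏ B ∈ S, k B (glue T.supp b (fun u => x u)) =
          k T (glue T.supp b (fun u => x u)) * ∏ B ∈ S.erase T, k B x := fun b => by
        rw [← Finset.mul_prod_erase S _ hT]
        exact congrArg _ (Finset.prod_congr rfl fun B hB => (hk B).apply_glue (hdisj B hB) b x)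
      rw [tsum_congr this, ENNReal.tsum_mul_right, hk₁, one_mul]
    have herase : ∀ x, ∏ B ∈ S.erase T, f B x = ∏ B ∈ S.erase T, g B x := fun x => by
      rw [← hsum f hf hf₁, ← hsum g hg hg₁]
      exact tsum_congr fun b => h _
    intro B hB
    by_cases hBT : B = T
    · subst hBT
      funext x
      have hx := h x
      rw [← Finset.mul_prod_erase S _ hT, ← Finset.mul_prod_erase S _ hT, ← herase] at hx
      exact (ENNReal.mul_left_inj (Finset.prod_ne_zero_iff.2 fun B _ => hf₀ B x)
        (ENNReal.prod_ne_top fun B _ => htop B x)).1 hx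
    · exact ih _ (Finset.erase_ssubset hT) herase B (Finset.mem_erase.2 ⟨hBT, hB⟩)

end MixedGraph

namespace Potentials

variable {V : Type*} [Finite V] {X : V → Type*} {G : MixedGraph V}

/-- The normalised factor of the block `B`. -/
noncomputable def kernel (φ : Potentials X) (G : MixedGraph V) (B : G.Block) (x : ∀ u, X u) :
    ℝ≥0∞ :=
  φ.weight G B x / φ.Z G B x

theorem truncated_eq (φ : Potentials X) (A : Set V) (x : ∀ u, X u) :
    φ.truncated G A x = ∏ B ∈ G.blocksAvoiding A, φ.kernel G B x := rfl

theorem dependsOn_weight (φ : Potentials X) (B : G.Block) :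
    DependsOn (φ.weight G B) (G.fa B.supp) := fun x y hxy =>
  Finset.prod_congr rfl fun C hC => by
    have : (fun u : C => x u) = fun u : C => y u :=
      funext fun u => hxy u (MixedGraph.subset_fa_of_mem_cliques hC u.2)
    rw [this]

theorem dependsOn_Z (φ : Potentials X) (B : G.Block) :
    DependsOn (φ.Z G B) (G.pa B.supp) := fun _ _ hxy =>
  tsum_congr fun b => φ.dependsOn_weight B fun u hu =>
    glue_congr b fun hu' => hxy u (hu.resolve_right hu')

theorem dependsOn_kernel (φ : Potentials X) (B : G.Block) :
    DependsOn (φ.kernel G B) (G.fa B.supp) := fun x y hxy => by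
  rw [kernel, kernel, φ.dependsOn_weight B hxy,
    φ.dependsOn_Z B fun u hu => hxy u (Set.mem_union_left _ hu)]

/-- A kernel that vanishes nowhere is normalised. Its normalising constant cannot be infinite,
since division by `∞` gives `0`. -/
theorem tsum_kernel (hG : G.IsChainGraph) {φ : Potentials X} {B : G.Block}
    (h : ∀ x, φ.kernel G B x ≠ 0) (x : ∀ u, X u) :
    ∑' b : Config X B.supp, φ.kernel G B (glue B.supp b (fun u => x u)) = 1 := by
  have hx := h x
  rw [kernel, Ne, ENNReal.div_eq_zero_iff, not_or] at hx
  have hZ : φ.Z G B x ≠ 0 := fun h0 => by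
    have := ENNReal.tsum_eq_zero.1 h0 (fun u => x u)
    rw [glue_restrict] at this
    exact hx.1 this
  simp_rw [kernel, (φ.dependsOn_Z B).apply_glue (hG.disjoint_pa B), div_eq_mul_inv]
  rw [ENNReal.tsum_mul_right]
  exact ENNReal.mul_inv_cancel hZ hx.2

end Potentials

/-! ### The law of the responses -/

namespace SaturatedCGM

variable {V : Type*} {X : V → Type*} [∀ v, MeasurableSpace (X v)]
  {Ω : Type*} [MeasurableSpace Ω] {K : MixedGraph V} {μ : Measure Ω}

/-- The probability `p(B = x_B | pa(B) = x_{pa(B)})` that the one step ahead block `B` with parents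
set according to `x` takes the values given by `x`. -/
noncomputable def blockProb (M : SaturatedCGM K X μ) (B : K.Block) (x : ∀ u, X u) : ℝ≥0∞ :=
  μ {ω | M.step B (fun u => x u) ω = fun u : B.supp => x u}

theorem blockProb_ne_zero (M : SaturatedCGM K X μ) (B : K.Block) (x : ∀ u, X u) :
    M.blockProb B x ≠ 0 := (M.pos B _ _).ne'

variable [Finite V]

open Classical in
theorem response_eq (M : SaturatedCGM K X μ) (hK : K.IsChainGraph) (A : Set V) (a : Config X A)
    (ω : Ω) (v : V) :
    M.response hK A a ω v = M.step (K.blockOf v)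
      (fun u => if h : (u : V) ∈ A then a ⟨u, h⟩ else M.response hK A a ω u) ω ⟨v, rfl⟩ :=
  hK.wellFounded.fix_eq _ v

/-- The responses to an intervention take given values if and only if every one step ahead block
avoiding the intervention does, with its parents set to those values. -/
theorem response_eq_iff (M : SaturatedCGM K X μ) (hK : K.IsChainGraph) {A : Set V}
    (hA : K.IsValid A) (a : Config X A) (v : Config X Aᶜ) (ω : Ω) :
    (∀ u : (Aᶜ : Set V), M.response hK A a ω u = v u) ↔
      ∀ B ∈ K.blocksAvoiding A,
        M.step B (fun u => glue A a v u) ω = fun u : B.supp => glue A a v u := by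
  classical
  constructor
  · intro h B hB
    funext ⟨w, hw⟩
    obtain rfl : K.blockOf w = B := hw
    have hwA : w ∉ A := fun h => Set.disjoint_left.1 (MixedGraph.mem_blocksAvoiding.1 hB) rfl h
    refine Eq.trans ?_ ((h ⟨w, hwA⟩).trans (glue_of_notMem _ _ hwA).symm)
    rw [M.response_eq]
    congr 2
    funext u
    by_cases hu : (u : V) ∈ A
    · rw [dif_pos hu, glue_of_mem _ _ hu]
    · rw [dif_neg hu, glue_of_notMem _ _ hu, h ⟨u, hu⟩]
  · rintro h ⟨w, hw⟩
    induction w using hK.wellFounded.induction with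
    | _ w ih =>
      have hB : K.blockOf w ∈ K.blocksAvoiding A := by
        rw [MixedGraph.mem_blocksAvoiding]
        by_contra hn
        exact hw (hA _ (Set.not_disjoint_iff_nonempty_inter.1 hn) rfl)
      rw [M.response_eq]
      refine Eq.trans ?_ ((congrFun (h _ hB) ⟨w, rfl⟩).trans (glue_of_notMem _ _ hw))
      congr 2
      funext u
      by_cases hu : (u : V) ∈ A
      · rw [dif_pos hu, glue_of_mem _ _ hu]
      · rw [dif_neg hu, glue_of_notMem _ _ hu, ih u u.2 hu]

/-- Without intervention, the responses are the observed variables. -/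
theorem observed_eq_iff (M : SaturatedCGM K X μ) (hK : K.IsChainGraph) (x : ∀ u, X u) (ω : Ω) :
    M.observed hK ω = x ↔ ∀ u : ((∅ : Set V)ᶜ : Set V),
      M.response hK ∅ (fun u => x u) ω u = x u := by
  have : (fun u : (∅ : Set V) => absurd u.2 (Set.notMem_empty _)) = fun u : (∅ : Set V) => x u :=
    funext fun u => absurd u.2 (Set.notMem_empty _)
  rw [observed, this]
  exact ⟨fun h u => congrFun h u, fun h => funext fun u => h ⟨u, Set.notMem_empty u⟩⟩

variable [∀ v, Countable (X v)] [∀ v, DiscreteMeasurableSpace (X v)]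

theorem measurableSet_step_eq (M : SaturatedCGM K X μ) (B : K.Block) (a : Config X (K.pa B.supp))
    (b : Config X B.supp) : MeasurableSet {ω | M.step B a ω = b} :=
  M.measurable_step B a (measurableSet_singleton b)

theorem measure_response (M : SaturatedCGM K X μ) (hK : K.IsChainGraph) {A : Set V}
    (hA : K.IsValid A) (a : Config X A) (v : Config X Aᶜ) :
    μ {ω | ∀ u : (Aᶜ : Set V), M.response hK A a ω u = v u} =
      ∏ B ∈ K.blocksAvoiding A, M.blockProb B (glue A a v) := by
  have hset : {ω | ∀ u : (Aᶜ : Set V), M.response hK A a ω u = v u} =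
      ⋂ B ∈ K.blocksAvoiding A, (fun ω (a : Config X (K.pa B.supp)) => M.step B a ω) ⁻¹'
        {f | f (fun u => glue A a v u) = fun u : B.supp => glue A a v u} := by
    ext ω
    rw [Set.mem_ofPred_eq, M.response_eq_iff hK hA]
    simp only [Set.mem_iInter, Set.mem_preimage, Set.mem_ofPred_eq]
  rw [hset]
  exact M.indep.measure_inter_preimage_eq_mul _ fun B _ =>
    measurable_pi_apply (fun u : K.pa B.supp => glue A a v u) (measurableSet_singleton _)

theorem measure_observed (M : SaturatedCGM K X μ) (hK : K.IsChainGraph) (x : ∀ u, X u) :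
    μ {ω | M.observed hK ω = x} = ∏ B ∈ K.blocksAvoiding ∅, M.blockProb B x := by
  have hA : K.IsValid ∅ := fun B h => by simp at h
  have := M.measure_response hK hA (fun u => x u) (fun u => x u)
  rw [glue_restrict] at this
  rw [← this]
  simp_rw [M.observed_eq_iff hK]

theorem measurableSet_response_eq (M : SaturatedCGM K X μ) (hK : K.IsChainGraph) {A : Set V}
    (hA : K.IsValid A) (a : Config X A) (v : Config X Aᶜ) :
    MeasurableSet {ω | ∀ u : (Aᶜ : Set V), M.response hK A a ω u = v u} := by
  simp_rw [M.response_eq_iff hK hA]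
  simp_rw [Set.ofPred_forall]
  exact Finset.measurableSet_biInter _ fun B _ => M.measurableSet_step_eq B _ _

/-- The law of some of the responses is a marginal of the law of all of them. -/
theorem measure_response_marginal (M : SaturatedCGM K X μ) (hK : K.IsChainGraph) {A : Set V}
    (hA : K.IsValid A) (a : Config X A) {Y : Set V} (hY : Y ⊆ Aᶜ) (y : Config X Y) :
    μ {ω | ∀ u : Y, M.response hK A a ω u = y u} =
      ∑' w : Config X (Aᶜ \ Y),
        μ {ω | ∀ u : (Aᶜ : Set V), M.response hK A a ω u = mergeValues Y y w u} := by
  rw [← measure_iUnion _ fun w => M.measurableSet_response_eq hK hA a _]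
  · congr 1
    ext ω
    simp only [Set.mem_ofPred_eq, Set.mem_iUnion]
    constructor
    · refine fun h => ⟨fun u => M.response hK A a ω u, fun u => ?_⟩
      by_cases hu : (u : V) ∈ Y
      · rw [mergeValues, dif_pos hu, ← h ⟨u, hu⟩]
      · rw [mergeValues, dif_neg hu]
    · rintro ⟨w, h⟩ u
      rw [h ⟨u, hY u.2⟩, mergeValues, dif_pos u.2]
  · intro w w' hne
    refine Set.disjoint_left.2 fun ω h h' => hne (funext fun u => ?_)
    have := (h ⟨u, u.2.1⟩).symm.trans (h' ⟨u, u.2.1⟩)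
    rwa [mergeValues, mergeValues, dif_neg u.2.2, dif_neg u.2.2] at this

theorem tsum_blockProb [IsProbabilityMeasure μ] (M : SaturatedCGM K X μ) (hK : K.IsChainGraph)
    (B : K.Block) (x : ∀ u, X u) :
    ∑' b : Config X B.supp, M.blockProb B (glue B.supp b (fun u => x u)) = 1 := by
  have hpa : ∀ b : Config X B.supp,
      (fun u : K.pa B.supp => glue B.supp b (fun u => x u) u) = fun u : K.pa B.supp => x u := fun b =>
    funext fun u => glue_of_notMem _ _ (Set.disjoint_left.1 (hK.disjoint_pa B) u.2)
  simp_rw [blockProb, hpa, restrict_glue]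
  rw [← measure_iUnion _ fun b => M.measurableSet_step_eq B _ b]
  · rw [← measure_univ (μ := μ)]
    congr 1
    ext ω
    simp
  · intro b b' hne
    exact Set.disjoint_left.2 fun ω h h' => hne (Eq.trans (Eq.symm h) h')

end SaturatedCGM

/-! ### Möbius inversion and interactions -/

section Moebius

variable {V : Type*}

/-- The Möbius transform of a function of finite sets. -/
def moebiusTransform (h : Finset V → ℝ) (D : Finset V) : ℝ :=
  ∑ E ∈ D.powerset, (-1) ^ (D.card + E.card) * h E

theorem moebiusTransform_congr {h h' : Finset V → ℝ} {D : Finset V} (hh : ∀ E ⊆ D, h E = h' E) :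
    moebiusTransform h D = moebiusTransform h' D :=
  Finset.sum_congr rfl fun E hE => by rw [hh E (Finset.mem_powerset.1 hE)]

theorem moebiusTransform_zero (D : Finset V) : moebiusTransform (fun _ => 0) D = 0 := by
  simp [moebiusTransform]

variable [DecidableEq V]

theorem moebiusTransform_insert (h : Finset V → ℝ) {i : V} {D : Finset V} (hi : i ∉ D) :
    moebiusTransform h (insert i D) = moebiusTransform (fun E => h (insert i E) - h E) D := by
  rw [moebiusTransform, moebiusTransform, Finset.sum_powerset_insert hi, ← Finset.sum_add_distrib]
  refine Finset.sum_congr rfl fun E hE => ?_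
  rw [Finset.card_insert_of_notMem hi,
    Finset.card_insert_of_notMem fun h => hi (Finset.mem_powerset.1 hE h)]
  ring

theorem sum_moebiusTransform (h : Finset V → ℝ) (s : Finset V) :
    ∑ D ∈ s.powerset, moebiusTransform h D = h s := by
  induction s using Finset.induction_on generalizing h with
  | empty => simp [moebiusTransform]
  | insert i s hi ih =>
    have : ∀ D ∈ s.powerset, moebiusTransform h (insert i D) =
        moebiusTransform (fun E => h (insert i E) - h E) D := fun D hD =>
      moebiusTransform_insert h fun h => hi (Finset.mem_powerset.1 hD h)
    rw [Finset.sum_powerset_insert hi, Finset.sum_congr rfl this, ih, ih]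
    ring

variable {X : V → Type*}

/-- The interaction of the variables in `D` in the function `H`, relative to the reference values
`o`: the Möbius transform of `E ↦ H (x on E, o off E)`. -/
def interaction (H : (∀ u, X u) → ℝ) (o : ∀ u, X u) (D : Finset V) (x : ∀ u, X u) : ℝ :=
  moebiusTransform (fun E => H (E.piecewise x o)) D

theorem dependsOn_interaction (H : (∀ u, X u) → ℝ) (o : ∀ u, X u) (D : Finset V) :
    DependsOn (interaction H o D) (D : Set V) := fun x y hxy =>
  moebiusTransform_congr fun E hE => congrArg H <| funext fun u => by
    by_cases hu : u ∈ E
    · simp [hu, hxy u (hE hu)]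
    · simp [hu]

theorem sum_interaction [Fintype V] (H : (∀ u, X u) → ℝ) (o x : ∀ u, X u) :
    ∑ D : Finset V, interaction H o D x = H x := by
  rw [← Finset.powerset_univ]
  simp_rw [interaction]
  rw [sum_moebiusTransform, Finset.piecewise_univ]

theorem interaction_eq_zero_of_disjoint {H : (∀ u, X u) → ℝ} {o : ∀ u, X u} {S : Set V}
    (hH : ∀ x, (∀ u ∈ S, x u = o u) → H x = 0) {D : Finset V} (hD : ∀ u ∈ D, u ∉ S) :
    interaction H o D = 0 := by
  funext x
  refine (moebiusTransform_congr fun E hE => hH _ fun u hu => ?_).trans (moebiusTransform_zero D)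
  exact Finset.piecewise_eq_of_notMem _ _ _ fun h => hD u (hE h) hu

/-- If the effect of the `i`-th coordinate on `H` does not depend on the `k`-th coordinate, no
interaction involves both. -/
theorem interaction_eq_zero_of_dependsOn {H : (∀ u, X u) → ℝ} {o : ∀ u, X u} {i k : V} {S : Set V}
    (hS : DependsOn (fun x => H x - H (Function.update x i (o i))) S) (hk : k ∉ S) (hik : k ≠ i)
    {D : Finset V} (hi : i ∈ D) (hkD : k ∈ D) : interaction H o D = 0 := by
  funext x
  have hiE : i ∉ insert k ((D.erase i).erase k) := by simp [hik.symm]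
  have hD : D = insert i (insert k ((D.erase i).erase k)) := by
    rw [Finset.insert_erase (Finset.mem_erase.2 ⟨hik, hkD⟩), Finset.insert_erase hi]
  rw [interaction, hD, moebiusTransform_insert _ hiE,
    moebiusTransform_insert _ (Finset.notMem_erase _ _)]
  refine (moebiusTransform_congr fun E hE => ?_).trans (moebiusTransform_zero _)
  -- Removing `i` from the set of active coordinates resets the `i`-th coordinate to `o i`.
  have hreset : ∀ F : Finset V, i ∉ F →
      F.piecewise x o = Function.update ((insert i F).piecewise x o) i (o i) := fun F hF => by
    rw [Finset.piecewise_insert, Function.update_idem, eq_comm, Function.update_eq_self_iff,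
      Finset.piecewise_eq_of_notMem _ _ _ hF]
  have hiE' : i ∉ insert k E := fun h => hiE (Finset.insert_subset_insert k hE h)
  rw [hreset _ hiE', hreset E fun h => hiE' (Finset.mem_insert_of_mem h), sub_eq_zero]
  refine hS fun u hu => ?_
  have huk : u ≠ k := fun h => hk (h ▸ hu)
  by_cases hui : u ∈ insert i E
  · rw [Finset.piecewise_eq_of_mem _ _ _ hui, Finset.piecewise_eq_of_mem]
    simp only [Finset.mem_insert] at hui ⊢
    tauto
  · rw [Finset.piecewise_eq_of_notMem _ _ _ hui, Finset.piecewise_eq_of_notMem]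
    simp only [Finset.mem_insert] at hui ⊢
    tauto

end Moebius

/-! ### Potentials from interactions -/

namespace MixedGraph

variable {V : Type*} {G : MixedGraph V}

/-- The vertex `i` together with its neighbours and its parents. -/
def closedBoundary (G : MixedGraph V) (i : V) : Set V :=
  {u | u = i ∨ G.undir.Adj i u ∨ G.Dir u i}

/-- A clique, not necessarily maximal, of `(G_{fa(B)})^a` that meets the block `B`. -/
def IsRelevantClique (G : MixedGraph V) (B : G.Block) (D : Set V) : Prop :=
  D ⊆ G.fa B.supp ∧ (G.augmented B.supp).IsClique D ∧ ∃ u ∈ D, u ∈ B.supp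

theorem IsRelevantClique.exists_subset_mem_cliques [Finite V] (hG : G.IsChainGraph) {B : G.Block}
    {D : Set V} (hD : G.IsRelevantClique B D) : ∃ C ∈ G.cliques B, D ⊆ C := by
  obtain ⟨C, hDC, hC⟩ := Finite.exists_le_maximal
    (p := fun D : Set V => D ⊆ G.fa B.supp ∧ (G.augmented B.supp).IsClique D) ⟨hD.1, hD.2.1⟩
  obtain ⟨u, hu, huB⟩ := hD.2.2
  exact ⟨C, (Set.Finite.mem_toFinset _).2 ⟨hC, fun h =>
    Set.disjoint_left.1 (hG.disjoint_pa B) (h (hDC hu)) huB⟩, hDC⟩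

end MixedGraph

namespace Potentials

variable {V : Type*} [Fintype V] {X : V → Type*} {G : MixedGraph V}

/-- Exponentials of sums of interactions of relevant cliques are products of potentials: each
interaction is absorbed into one maximal clique. -/
theorem exists_weight_eq_exp (hG : G.IsChainGraph) (o : ∀ u, X u)
    {U : G.Block → Finset V → (∀ u, X u) → ℝ} (hU : ∀ B D, DependsOn (U B D) (D : Set V))
    (hU' : ∀ B D, U B D ≠ 0 → G.IsRelevantClique B D) :
    ∃ φ : Potentials X, ∀ B x,
      φ.weight G B x = ENNReal.ofReal (Real.exp (∑ D : Finset V, U B D x)) := by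
  classical
  have := Fintype.ofFinite G.Block
  have hc : ∀ B D, ∃ C, U B D ≠ 0 → C ∈ G.cliques B ∧ (D : Set V) ⊆ C := fun B D => by
    by_cases h : U B D = 0
    · exact ⟨∅, fun h' => absurd h h'⟩
    · obtain ⟨C, hC⟩ := (hU' B D h).exists_subset_mem_cliques hG
      exact ⟨C, fun _ => hC⟩
  choose c hc using hc
  -- The sum over `B` has at most one nonzero term, as `C` is relevant for at most one block.
  refine ⟨fun C y => (Real.exp (∑ B : G.Block, ∑ D : Finset V,
    if C ∈ G.cliques B ∧ c B D = C then U B D (glue C y (fun u => o u)) else 0)).toNNReal,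
    fun B x => ?_⟩
  change ∏ C ∈ G.cliques B, ENNReal.ofReal _ = _
  rw [← ENNReal.ofReal_prod_of_nonneg fun _ _ => (Real.exp_pos _).le, ← Real.exp_sum]
  congr 2
  calc _ = ∑ C ∈ G.cliques B, ∑ D : Finset V,
        if c B D = C then U B D (glue C (fun u => x u) (fun u => o u)) else 0 := by
        refine Finset.sum_congr rfl fun C hC => ?_
        rw [Finset.sum_eq_single B]
        · simp [hC]
        · refine fun B' _ hne => Finset.sum_eq_zero fun D _ => if_neg fun h => hne ?_
          exact hG.block_unique (MixedGraph.subset_fa_of_mem_cliques h.1)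
            (MixedGraph.exists_mem_supp_of_mem_cliques h.1)
            (MixedGraph.subset_fa_of_mem_cliques hC) (MixedGraph.exists_mem_supp_of_mem_cliques hC)
        · exact fun h => absurd (Finset.mem_univ B) h
    _ = ∑ D : Finset V, U B D x := by
        rw [Finset.sum_comm]
        refine Finset.sum_congr rfl fun D _ => ?_
        by_cases h : U B D = 0
        · simp [h]
        · obtain ⟨hC, hDC⟩ := hc B D h
          rw [Finset.sum_eq_single (c B D), if_pos rfl]
          · exact hU B D fun u hu => glue_of_mem _ _ (hDC hu)
          · exact fun C _ hne => if_neg hne.symm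
          · exact fun h => absurd hC h

end Potentials

/-! ### The Hammersley–Clifford factorisation of the one step ahead blocks -/

namespace SaturatedCGM

variable {V : Type*} {X : V → Type*} [∀ v, MeasurableSpace (X v)]
  {Ω : Type*} [MeasurableSpace Ω] {K G : MixedGraph V} {μ : Measure Ω}

/-- The log-probability of the one step ahead block `B`, relative to the reference values `o`. -/
noncomputable def logRatio (M : SaturatedCGM K X μ) (B : K.Block) (o x : ∀ u, X u) : ℝ :=
  Real.log (M.blockProb B x).toReal -
    Real.log (M.blockProb B (glue B.supp (fun u => o u) (fun u => x u))).toReal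

theorem blockProb_ne_top [IsFiniteMeasure μ] (M : SaturatedCGM K X μ) (B : K.Block)
    (x : ∀ u, X u) : M.blockProb B x ≠ ∞ := measure_ne_top _ _

theorem toReal_blockProb_pos [IsFiniteMeasure μ] (M : SaturatedCGM K X μ) (B : K.Block)
    (x : ∀ u, X u) : 0 < (M.blockProb B x).toReal :=
  ENNReal.toReal_pos (M.blockProb_ne_zero B x) (M.blockProb_ne_top B x)

theorem logRatio_eq_zero (M : SaturatedCGM K X μ) (B : K.Block) (o x : ∀ u, X u)
    (h : ∀ u ∈ B.supp, x u = o u) : M.logRatio B o x = 0 := by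
  have : glue B.supp (fun u => o u) (fun u => x u) = x := by
    funext u
    by_cases hu : u ∈ B.supp
    · rw [glue_of_mem _ _ hu, h u hu]
    · exact glue_of_notMem _ _ hu
  rw [logRatio, this, sub_self]

theorem ofReal_exp_logRatio [IsFiniteMeasure μ] (M : SaturatedCGM K X μ) (B : K.Block)
    (o x : ∀ u, X u) : M.blockProb B x =
      M.blockProb B (glue B.supp (fun u => o u) (fun u => x u)) *
        ENNReal.ofReal (Real.exp (M.logRatio B o x)) := by
  have h₁ := M.toReal_blockProb_pos B x
  have h₂ := M.toReal_blockProb_pos B (glue B.supp (fun u => o u) (fun u => x u))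
  rw [logRatio, Real.exp_sub, Real.exp_log h₁, Real.exp_log h₂,
    ← ENNReal.ofReal_toReal (a := M.blockProb B (glue B.supp (fun u => o u) (fun u => x u)))
      (M.blockProb_ne_top B _), ENNReal.toReal_ofReal h₂.le, ← ENNReal.ofReal_mul h₂.le,
    mul_div_cancel₀ _ h₂.ne', ENNReal.ofReal_toReal (M.blockProb_ne_top B x)]

variable [Finite V] [∀ v, Countable (X v)] [∀ v, DiscreteMeasurableSpace (X v)]

/-- The effect of the `i`-th coordinate on the log-probability of its block depends only on
the values at `i` and at its neighbours and parents in `G`: it is a log-ratio of two conditional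
probabilities with the same condition. -/
theorem dependsOn_logRatio_sub [IsProbabilityMeasure μ] [DecidableEq V] {M : SaturatedCGM K X μ}
    (hK : K.IsChainGraph) (hM : M.IsRestrictedTo G) (B : K.Block) (o : ∀ u, X u) {i : V}
    (hi : i ∈ B.supp) :
    DependsOn (fun x => M.logRatio B o x - M.logRatio B o (Function.update x i (o i)))
      (G.closedBoundary i) := by
  -- The probability of the remaining coordinates of the block.
  let R : (∀ u, X u) → ℝ≥0∞ := fun x =>
    μ {ω | ∀ j : B.supp, j ≠ ⟨i, hi⟩ → M.step B (fun u => x u) ω j = x j}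
  have hR₀ : ∀ x, 0 < (R x).toReal := fun x => by
    refine ENNReal.toReal_pos (fun h => M.blockProb_ne_zero B x (measure_mono_null ?_ h))
      (measure_ne_top _ _)
    exact fun ω hω j _ => congrFun hω j
  have hR : ∀ x c, R (Function.update x i c) = R x := fun x c => by
    have hpa : (fun u : K.pa B.supp => Function.update x i c u) = fun u : K.pa B.supp => x u :=
      funext fun u => Function.update_of_ne
        (fun h : (u : V) = i => Set.disjoint_left.1 (hK.disjoint_pa B) u.2 (h ▸ hi)) _ _
    refine congrArg μ (Set.ext fun ω => forall_congr' fun j => forall_congr' fun hj => ?_)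
    rw [hpa, Function.update_of_ne fun h => hj (Subtype.ext h)]
  have hcond : ∀ x y : ∀ u, X u, (∀ u ∈ G.closedBoundary i, x u = y u) →
      Real.log (M.blockProb B x).toReal - Real.log (R x).toReal =
        Real.log (M.blockProb B y).toReal - Real.log (R y).toReal := by
    intro x y hxy
    have h := hM B ⟨i, hi⟩ (fun u => x u) (fun u => y u) (fun u => x u) (fun u => y u)
      (fun u hu => hxy u (Or.inr (Or.inr hu))) (hxy i (Or.inl rfl))
      (fun j hj => hxy j (Or.inr (Or.inl hj)))
    have hcond_apply : ∀ x : ∀ u, X u,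
        (cond μ {ω | ∀ j : B.supp, j ≠ ⟨i, hi⟩ → M.step B (fun u => x u) ω j = x j})
          {ω | M.step B (fun u => x u) ω ⟨i, hi⟩ = x i} = (R x)⁻¹ * M.blockProb B x := by
      intro x
      rw [cond_apply]
      · congr 2
        ext ω
        constructor
        · rintro ⟨h₁, h₂⟩
          funext j
          by_cases hj : j = ⟨i, hi⟩
          · subst hj
            exact h₂
          · exact h₁ j hj
        · exact fun h => ⟨fun j _ => congrFun h j, congrFun h ⟨i, hi⟩⟩
      · exact M.measurable_step B (fun u => x u)
          (Set.to_countable {b : Config X B.supp | ∀ j, j ≠ ⟨i, hi⟩ → b j = x j}).measurableSet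
    have h' := (hcond_apply x).symm.trans (h.trans (hcond_apply y))
    have h'' := congrArg (fun p => Real.log p.toReal) h'
    simp only [ENNReal.toReal_mul, ENNReal.toReal_inv] at h''
    rw [Real.log_mul (inv_ne_zero (hR₀ x).ne') (M.toReal_blockProb_pos B x).ne',
      Real.log_mul (inv_ne_zero (hR₀ y).ne') (M.toReal_blockProb_pos B y).ne',
      Real.log_inv, Real.log_inv] at h''
    linarith
  intro x y hxy
  have hglue : ∀ x : ∀ u, X u,
      glue B.supp (fun u => o u) (fun u => Function.update x i (o i) u) =
        glue B.supp (fun u => o u) (fun u => x u) := fun x => funext fun u =>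
    glue_congr _ fun hu => Function.update_of_ne (fun h : u = i => hu (h ▸ hi)) _ _
  have h₁ := hcond x y hxy
  have h₂ := hcond (Function.update x i (o i)) (Function.update y i (o i)) fun u hu => by
    by_cases hui : u = i
    · subst hui
      simp
    · rw [Function.update_of_ne hui, Function.update_of_ne hui, hxy u hu]
  rw [hR, hR] at h₂
  simp only [logRatio, hglue]
  linarith

/-- The interactions of a one step ahead block of `K` vanish except on the relevant cliques of the
blocks of `G` inside it. -/
theorem exists_isRelevantClique [IsProbabilityMeasure μ] [DecidableEq V] {M : SaturatedCGM K X μ}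
    (hK : K.IsChainGraph) (hGK : G.IsEdgeSubgraph K) (hM : M.IsRestrictedTo G) (B : K.Block)
    (o : ∀ u, X u) {D : Finset V} (hD : interaction (M.logRatio B o) o D ≠ 0) :
    ∃ B' : G.Block, B'.supp ⊆ B.supp ∧ G.IsRelevantClique B' D := by
  have hbd : ∀ i ∈ D, i ∈ B.supp → ∀ k ∈ D, k ∈ G.closedBoundary i := by
    intro i hi hiB k hk
    by_contra h
    exact hD (interaction_eq_zero_of_dependsOn (dependsOn_logRatio_sub hK hM B o hiB) h
      (fun hki => h (Or.inl hki)) hi hk)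
  have hmeet : ∃ i ∈ D, i ∈ B.supp := by
    by_contra! h
    exact hD (interaction_eq_zero_of_disjoint (fun x => M.logRatio_eq_zero B o x) h)
  obtain ⟨i, hi, hiB⟩ := hmeet
  have hsub : (G.blockOf i).supp ⊆ B.supp :=
    hGK.coarsen_eq_iff.1 (show hGK.coarsen (G.blockOf i) = B from hiB)
  have hcases : ∀ u ∈ D, u ∈ (G.blockOf i).supp ∨ u ∉ B.supp ∧ u ∈ G.pa (G.blockOf i).supp := by
    intro u hu
    rcases hbd i hi hiB u hu with rfl | h | h
    · exact Or.inl rfl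
    · exact Or.inl (SimpleGraph.ConnectedComponent.connectedComponentMk_eq_of_adj h).symm
    · exact Or.inr ⟨Set.disjoint_left.1 (hK.disjoint_pa B) ⟨i, hiB, hGK.1 _ _ h⟩, i, rfl, h⟩
  have hfa : (D : Set V) ⊆ G.fa (G.blockOf i).supp := fun u hu =>
    (hcases u hu).elim Or.inr fun h => Or.inl h.2
  refine ⟨G.blockOf i, hsub, hfa, ?_, i, hi, rfl⟩
  intro u hu v hv huv
  refine ⟨huv, hfa hu, hfa hv, ?_⟩
  rcases hcases u hu with hu' | hu'
  · rcases hbd u hu (hsub hu') v hv with h | h | h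
    · exact absurd h.symm huv
    · exact Or.inl (Or.inr (Or.inr h))
    · exact Or.inl (Or.inr (Or.inl h))
  · rcases hcases v hv with hv' | hv'
    · rcases hbd v hv (hsub hv') u hu with h | h | h
      · exact absurd h huv
      · exact Or.inl (Or.inr (Or.inr h.symm))
      · exact Or.inl (Or.inl h)
    · exact Or.inr ⟨⟨hu'.2, fun h => hu'.1 (hsub h)⟩, ⟨hv'.2, fun h => hv'.1 (hsub h)⟩⟩

/-- The law of each one step ahead block is a product of kernels of the blocks of `G` inside it. -/
theorem exists_blockProb_eq_prod_kernel [IsProbabilityMeasure μ] {M : SaturatedCGM K X μ}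
    (hK : K.IsChainGraph) (hGK : G.IsEdgeSubgraph K) (hM : M.IsRestrictedTo G) (o : ∀ u, X u) :
    ∃ φ : Potentials X, ∀ (B : K.Block) (x : ∀ u, X u),
      M.blockProb B x = ∏ B' ∈ G.blocksWithin B.supp, φ.kernel G B' x := by
  classical
  have := Fintype.ofFinite V
  have hG := hGK.isChainGraph hK
  obtain ⟨φ, hφ⟩ := Potentials.exists_weight_eq_exp hG o
    (U := fun B' D => if G.IsRelevantClique B' D
      then interaction (M.logRatio (hGK.coarsen B') o) o D else 0)
    (fun B' D => by
      split_ifs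
      · exact dependsOn_interaction _ _ _
      · exact fun _ _ _ => rfl)
    (fun B' D h => by
      by_contra h'
      exact h (if_neg h'))
  refine ⟨φ, fun B x => ?_⟩
  have hprod : ∀ x, M.blockProb B x =
      M.blockProb B (glue B.supp (fun u => o u) (fun u => x u)) *
        ∏ B' ∈ G.blocksWithin B.supp, φ.weight G B' x := by
    intro x
    simp_rw [hφ]
    rw [← ENNReal.ofReal_prod_of_nonneg fun _ _ => (Real.exp_pos _).le, ← Real.exp_sum,
      M.ofReal_exp_logRatio B o x]
    congr 3
    rw [Finset.sum_comm, ← sum_interaction (M.logRatio B o) o x]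
    refine Finset.sum_congr rfl fun D _ => ?_
    by_cases h : interaction (M.logRatio B o) o D = 0
    · rw [h, Finset.sum_eq_zero]
      · rfl
      · intro B' hB'
        rw [hGK.coarsen_eq_iff.2 (MixedGraph.mem_blocksWithin.1 hB'), h, ite_self]
        rfl
    · obtain ⟨B', hB', hD⟩ := exists_isRelevantClique hK hGK hM B o h
      rw [Finset.sum_eq_single B', if_pos hD, hGK.coarsen_eq_iff.2 hB']
      · refine fun B'' _ hne => ?_
        rw [if_neg]
        · rfl
        · exact fun hD' => hne (hG.block_unique hD'.1 hD'.2.2 hD.1 hD.2.2)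
      · exact fun h => absurd (MixedGraph.mem_blocksWithin.2 hB') h
  -- Summing over the values of the block shows that the reference probability is the inverse of
  -- the product of the normalising constants.
  have hZ : M.blockProb B (glue B.supp (fun u => o u) (fun u => x u)) *
      ∏ B' ∈ G.blocksWithin B.supp, φ.Z G B' x = 1 := by
    have hQ : B.supp = ⋃ B' ∈ G.blocksWithin B.supp, B'.supp := by
      simp_rw [MixedGraph.mem_blocksWithin]
      exact (SimpleGraph.ConnectedComponent.biUnion_supp_eq_supp hGK.2 B).symm
    have hsum := tsum_glue_prod (G.blocksWithin B.supp) (P := fun B' => B'.supp)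
      (F := fun B' => G.fa B'.supp) (fun B₁ _ B₂ _ hne => MixedGraph.disjoint_supp hne)
      (fun B₁ h₁ B₂ h₂ hne => Set.disjoint_union_left.2
        ⟨(hK.disjoint_pa B).mono (hGK.pa_subset (MixedGraph.mem_blocksWithin.1 h₁))
          (MixedGraph.mem_blocksWithin.1 h₂), MixedGraph.disjoint_supp hne⟩)
      (fun B' _ => φ.dependsOn_weight B') hQ x
    refine Eq.trans ?_ (M.tsum_blockProb hK B x)
    rw [tsum_congr fun b => hprod _]
    have hglue : ∀ b : Config X B.supp,
        glue B.supp (fun u => o u) (fun u => glue B.supp b (fun u => x u) u) =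
          glue B.supp (fun u => o u) (fun u => x u) := fun b => funext fun u =>
      glue_congr _ fun hu => glue_of_notMem _ _ hu
    simp_rw [hglue]
    rw [ENNReal.tsum_mul_left, hsum]
    rfl
  have hZ₀ : ∀ B' ∈ G.blocksWithin B.supp, φ.Z G B' x ≠ 0 := fun B' hB' h0 => by
    rw [Finset.prod_eq_zero hB' h0, mul_zero] at hZ
    exact zero_ne_one hZ
  simp_rw [Potentials.kernel, div_eq_mul_inv]
  rw [Finset.prod_mul_distrib, hprod x, ENNReal.eq_inv_of_mul_eq_one_left hZ, mul_comm]
  congr 1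
  exact (ENNReal.prod_inv_distrib fun B₁ h₁ B₂ _ _ => Or.inl (hZ₀ B₁ h₁))

end SaturatedCGM

/-! ### The observed law determines the laws of the responses -/

/-- `K` is a complete chain graph, `G` is an edge subgraph of it, and `M` is a model in the chain
graph causal model associated with `G`. The law of the observed variables has clique potentials for
`G`, and any such potentials give the law of all responses to valid interventions. -/
theorem lemma5 {V : Type*} [Finite V] {X : V → Type*} [∀ v, Countable (X v)]
    [∀ v, MeasurableSpace (X v)] [∀ v, DiscreteMeasurableSpace (X v)]
    {Ω : Type*} [MeasurableSpace Ω] (μ : Measure Ω) [IsProbabilityMeasure μ]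
    (K G : MixedGraph V) (hK : K.IsChainGraph) (hKc : K.IsComplete) (hGK : G.IsEdgeSubgraph K)
    (M : SaturatedCGM K X μ) (hM : M.IsRestrictedTo G) :
    (∃ φ : Potentials X, φ.FactorizesObserved G M hK) ∧
    ∀ φ : Potentials X, φ.FactorizesObserved G M hK →
      ∀ A : Set V, K.IsValid A → ∀ a : Config X A,
        (∀ v : Config X Aᶜ,
          μ {ω | ∀ u : (Aᶜ : Set V), M.response hK A a ω u = v u} =
            φ.truncated G A (glue A a v)) ∧
        (∀ Y : Set V, Y ⊆ Aᶜ → ∀ y : Config X Y,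
          μ {ω | ∀ u : Y, M.response hK A a ω u = y u} =
            ∑' w : Config X (Aᶜ \ Y), φ.truncated G A (glue A a (mergeValues Y y w))) := by
  obtain ⟨ω₀⟩ := nonempty_of_isProbabilityMeasure μ
  have hG := hGK.isChainGraph hK
  have hempty : K.IsValid ∅ := fun B h => by simp at h
  obtain ⟨ψ, hψ⟩ :=
    SaturatedCGM.exists_blockProb_eq_prod_kernel hK hGK hM (M.observed hK ω₀)
  have hψtrunc : ∀ {A : Set V}, K.IsValid A → ∀ x,
      ∏ B ∈ K.blocksAvoiding A, M.blockProb B x = ψ.truncated G A x := fun hA x => by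
    rw [ψ.truncated_eq, hGK.prod_blocksAvoiding hA]
    exact Finset.prod_congr rfl fun B _ => hψ B x
  have hψobs : ψ.FactorizesObserved G M hK := fun x =>
    (M.measure_observed hK x).trans (hψtrunc hempty x)
  -- The observed law is positive, so that the kernels of every factorisation are.
  have hne : ∀ φ : Potentials X, φ.FactorizesObserved G M hK →
      ∀ B x, φ.kernel G B x ≠ 0 := fun φ hφ B x => by
    have h := hφ x
    rw [M.measure_observed hK, φ.truncated_eq] at h
    refine Finset.prod_ne_zero_iff.1 (h ▸ Finset.prod_ne_zero_iff.2 fun B _ =>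
      M.blockProb_ne_zero B x) B ?_
    exact MixedGraph.mem_blocksAvoiding.2 (Set.disjoint_empty _)
  refine ⟨⟨ψ, hψobs⟩, fun φ hφ A hA a => ?_⟩
  have hker : ∀ B, φ.kernel G B = ψ.kernel G B := fun B =>
    hG.kernel_unique φ.dependsOn_kernel ψ.dependsOn_kernel
      (fun B => Potentials.tsum_kernel hG (hne φ hφ B))
      (fun B => Potentials.tsum_kernel hG (hne ψ hψobs B)) (hne φ hφ) (G.blocksAvoiding ∅)
      (fun x => (hφ x).symm.trans (hψobs x)) B
      (MixedGraph.mem_blocksAvoiding.2 (Set.disjoint_empty _))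
  have hlaw : ∀ v : Config X Aᶜ,
      μ {ω | ∀ u : (Aᶜ : Set V), M.response hK A a ω u = v u} =
        φ.truncated G A (glue A a v) := fun v => by
    rw [M.measure_response hK hA, hψtrunc hA, ψ.truncated_eq, φ.truncated_eq]
    simp_rw [hker]
  refine ⟨hlaw, fun Y hY y => ?_⟩
  rw [M.measure_response_marginal hK hA a hY]
  exact tsum_congr fun w => hlaw _
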